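/- Let $G=(V,E)$ be a finite connected simple graph. Fix any orientation of its edges, let $\partial\in\mathbb Z^{V\times E}$ be the signed incidence matrix (the column of an edge has $-1$ in the row of its source, $+1$ in the row of its target and $0$ elsewhere), and let $\mathcal F(G)=\{x\in\mathbb Z^E:\partial x=0\}$ be the lattice of integral flows. Let $\mathbf f_1,\dots,\mathbf f_g$ be a $\mathbb Z$-basis of $\mathcal F(G)$, let $\iota$ be the $|E|\times g$ matrix with columns $\mathbf f_1,\dots,\mathbf f_g$, and let $\mathcal L^*=\iota^T\iota$ be the associated dual Laplacian. Suppose that $\{\mathbf f_1,\dots,\mathbf f_g\}$ is a cycle $M$-basis, that is, $\mathcal L^*$ is a (non-singular) $M$-matrix: $\mathcal L^*_{ij}\le 0$ for all $i\ne j$, and $\mathcal L^*$ is invertible over $\mathbb R$ with all entries of $(\mathcal L^*)^{-1}$ non-negative. Call $\mathbf c\in\mathbb Z^g$ a $z$-superstable cycle configuration (with respect to $\mathcal L^*$) if $\mathbf c\ge 0$ and for every $\mathbf z\in\mathbb Z^g$ with $\mathbf z\ge 0$ and $\mathbf z\ne\mathbf 0$ there is an index $i$ such that $c_i-(\mathcal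 L^*\mathbf z)_i<0$. Then the number of $z$-superstable cycle configurations is finite and equals the number of spanning trees of $G$. -/

import Mathlib

namespace CycleChipFiring

/-- An orientation of a simple graph: each edge is given a source and a target,
which are its two endpoints. -/
structure Orientation {V : Type*} (G : SimpleGraph V) where
  src : G.edgeSet → V
  tgt : G.edgeSet → V
  mk_src_tgt : ∀ e : G.edgeSet, s(src e, tgt e) = (e : Sym2 V)

/-- The signed incidence matrix `∂` of an oriented graph: the column of an edge has `-1` in the
row of its source, `1` in the row of its target and `0` elsewhere. -/
def Orientation.incidence {V : Type*} [DecidableEq V] {G : SimpleGraph V} (o : Orientation G) :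
    Matrix V G.edgeSet ℤ :=
  Matrix.of fun v e => if v = o.tgt e then 1 else if v = o.src e then -1 else 0

/-- The lattice of integral flows: the integer vectors in the kernel of `∂`. -/
def Orientation.flow {V : Type*} [DecidableEq V] {G : SimpleGraph V} [Fintype G.edgeSet]
    (o : Orientation G) : Submodule ℤ (G.edgeSet → ℤ) :=
  LinearMap.ker o.incidence.mulVecLin

section Basis

variable {V : Type*} [DecidableEq V] {G : SimpleGraph V} [Fintype G.edgeSet]
  {o : Orientation G} {g : ℕ}

/-- The `|E| × g` matrix `ι` whose columns are the basis elements. -/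
noncomputable def basisMatrix (f : Module.Basis (Fin g) ℤ o.flow) : Matrix G.edgeSet (Fin g) ℤ :=
  Matrix.of fun e i => (f i : G.edgeSet → ℤ) e

/-- The dual Laplacian `ιᵀ ι` of a basis of the lattice of integral flows. -/
noncomputable def dualLaplacian (f : Module.Basis (Fin g) ℤ o.flow) : Matrix (Fin g) (Fin g) ℤ :=
  (basisMatrix f).transpose * basisMatrix f

end Basis

/-- A Z-matrix: all off-diagonal entries are non-positive. -/
def IsZMatrix {n : ℕ} (L : Matrix (Fin n) (Fin n) ℝ) : Prop :=
  ∀ i j, i ≠ j → L i j ≤ 0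

/-- A (non-singular) M-matrix: an invertible Z-matrix whose inverse has non-negative entries. -/
def IsMMatrix {n : ℕ} (L : Matrix (Fin n) (Fin n) ℝ) : Prop :=
  IsZMatrix L ∧ IsUnit L.det ∧ ∀ i j, 0 ≤ L⁻¹ i j

/-- A basis of the lattice of integral flows is a cycle M-basis if its dual Laplacian,
viewed as a real matrix, is an M-matrix. -/
def IsCycleMBasis {V : Type*} [DecidableEq V] {G : SimpleGraph V} [Fintype G.edgeSet]
    {o : Orientation G} {g : ℕ} (f : Module.Basis (Fin g) ℤ o.flow) : Prop :=
  IsMMatrix ((dualLaplacian f).map (Int.cast : ℤ → ℝ))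

/-- A configuration `c ∈ ℤⁿ` is z-superstable with respect to `L` if `c ≥ 0` and firing any
nonzero multiset `z` of sites makes some site negative. -/
def IsZSuperstable {n : ℕ} (L : Matrix (Fin n) (Fin n) ℤ) (c : Fin n → ℤ) : Prop :=
  0 ≤ c ∧ ∀ z : Fin n → ℤ, 0 ≤ z → z ≠ 0 → ∃ i, c i - L.mulVec z i < 0

/-- The set of spanning trees of `G`: the trees on all of `V` all of whose edges are
edges of `G`. -/
def spanningTrees {V : Type*} (G : SimpleGraph V) : Set (SimpleGraph V) :=
  {T | T ≤ G ∧ T.IsTree}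

end CycleChipFiring

namespace CycleChipFiring

open Matrix

/-! Write L for the dual Laplacian. Each class of ℤ^g modulo L·ℤ^g contains exactly one
z-superstable configuration: existence comes from the non-negative inverse of L, uniqueness from the
signs off the diagonal. So the count is the index |det L| (`encard_isZSuperstable`).

As L is a Gram matrix, Cauchy–Binet makes det L the sum of the squared maximal minors of ι. A minor
is ±1 if its rows are the complement of a spanning tree, because flows restrict isomorphically to
that complement, and 0 otherwise. So det L counts spanning trees (`det_dualLaplacian`). -/

/-! ### Superstable configurations as coset representatives -/

/-- If `L` is a Z-matrix, two z-superstable configurations that differ by a vector `L w`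
differ by firing a non-positive vector. -/
lemma IsZSuperstable.nonpos_of_sub_mulVec {n : ℕ} {L : Matrix (Fin n) (Fin n) ℤ}
    (hL : ∀ i j, i ≠ j → L i j ≤ 0) {c w : Fin n → ℤ} (hc : IsZSuperstable L c)
    (hcw : 0 ≤ c - L *ᵥ w) : w ≤ 0 := by
  have key (u : Fin n → ℤ) (hu : 0 ≤ u) (i : Fin n) (hi : u i = 0) : (L *ᵥ u) i ≤ 0 := by
    rw [mulVec, dotProduct]
    refine Finset.sum_nonpos fun j _ => ?_
    by_cases hij : i = j
    · subst hij; simp [hi]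
    · exact mul_nonpos_of_nonpos_of_nonneg (hL i j hij) (hu j)
  by_contra hw
  have hne : w⁺ ≠ 0 := fun h => hw ((posPart_eq_zero (a := w)).mp h)
  obtain ⟨i, hi⟩ := hc.2 w⁺ (posPart_nonneg w) hne
  have hsum : (L *ᵥ w) i = (L *ᵥ w⁺) i - (L *ᵥ w⁻) i := by
    rw [← Pi.sub_apply, ← mulVec_sub, posPart_sub_negPart]
  have hcwi : 0 ≤ c i - (L *ᵥ w) i := hcw i
  have hci : 0 ≤ c i := hc.1 i
  -- If `w i > 0`, the negative part vanishes at `i`, so `(L w) i ≥ (L w⁺) i > c i`. Otherwise `w⁺`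
  -- vanishes at `i`, so `(L w⁺) i ≤ 0 ≤ c i`. Both are impossible.
  by_cases hwi : 0 < w i
  · have := key w⁻ (negPart_nonneg w) i (by
      rw [Pi.negPart_apply]; exact negPart_eq_zero.mpr hwi.le)
    omega
  · have := key w⁺ (posPart_nonneg w) i (by
      rw [Pi.posPart_apply]; exact posPart_eq_zero.mpr (not_lt.mp hwi))
    omega

/-- The roles of `c` and `d` are symmetric, so both `w` and `-w` are non-positive. -/
lemma IsZSuperstable.eq_of_sub_eq_mulVec {n : ℕ} {L : Matrix (Fin n) (Fin n) ℤ}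
    (hL : ∀ i j, i ≠ j → L i j ≤ 0) {c d w : Fin n → ℤ} (hc : IsZSuperstable L c)
    (hd : IsZSuperstable L d) (h : c - d = L *ᵥ w) : c = d := by
  have h1 : w ≤ 0 := hc.nonpos_of_sub_mulVec hL (by rw [← h, sub_sub_cancel]; exact hd.1)
  have h2 : -w ≤ 0 := hd.nonpos_of_sub_mulVec hL (by
    rw [mulVec_neg, ← h, sub_neg_eq_add, add_sub_cancel]; exact hc.1)
  have hw : w = 0 := le_antisymm h1 (by simpa using h2)
  rw [hw, mulVec_zero] at h
  exact sub_eq_zero.mp h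

lemma IsMMatrix.det_ne_zero {n : ℕ} {L : Matrix (Fin n) (Fin n) ℤ}
    (hL : IsMMatrix (L.map (Int.cast : ℤ → ℝ))) : L.det ≠ 0 := by
  intro h
  have h' := (Int.castRingHom ℝ).map_det L
  rw [h, map_zero] at h'
  exact hL.2.1.ne_zero h'.symm

/-- Every coset of the lattice generated by an M-matrix contains a z-superstable configuration. -/
lemma exists_isZSuperstable_sub_mulVec {n : ℕ} {L : Matrix (Fin n) (Fin n) ℤ}
    (hL : IsMMatrix (L.map (Int.cast : ℤ → ℝ))) (c : Fin n → ℤ) :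
    ∃ w, IsZSuperstable L (c - L *ᵥ w) := by
  have hdet0 := hL.det_ne_zero
  obtain ⟨-, hdet, hinv⟩ := hL
  set B := (L.map (Int.cast : ℤ → ℝ))⁻¹ with hB
  have hcast (z : Fin n → ℤ) :
      (fun i => ((L *ᵥ z) i : ℝ)) = L.map (Int.cast : ℤ → ℝ) *ᵥ fun i => (z i : ℝ) := by
    ext i
    simp [mulVec, dotProduct]
  have hBL (z : Fin n → ℤ) : (B *ᵥ fun i => ((L *ᵥ z) i : ℝ)) = fun i => (z i : ℝ) := by
    rw [hcast, mulVec_mulVec, hB, nonsing_inv_mul _ hdet, one_mulVec]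
  -- The entry sum of `L⁻¹ c` is a potential: non-negative when `c ≥ 0`, and lowered by `∑ z ≥ 1`
  -- when `z` is fired. Legal firings therefore stop.
  have descend (N : ℕ) : ∀ c : Fin n → ℤ, 0 ≤ c → ∑ i, (B *ᵥ fun i => (c i : ℝ)) i < N →
      ∃ w, IsZSuperstable L (c - L *ᵥ w) := by
    induction N with
    | zero =>
      intro c hc hlt
      refine absurd hlt (not_lt.mpr ?_)
      rw [Nat.cast_zero]
      refine Finset.sum_nonneg fun i _ => ?_
      rw [mulVec, dotProduct]
      exact Finset.sum_nonneg fun j _ =>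
        mul_nonneg (hinv i j) (Int.cast_nonneg (hc j))
    | succ N ih =>
      intro c hc hlt
      by_cases hss : IsZSuperstable L c
      · exact ⟨0, by simpa using hss⟩
      · simp only [IsZSuperstable, hc, true_and] at hss
        push Not at hss
        obtain ⟨z, hz, hz0, hcz⟩ := hss
        obtain ⟨w, hw⟩ := ih (c - L *ᵥ z) (fun i => hcz i) (by
          have h1 : (B *ᵥ fun i => (((c - L *ᵥ z) i : ℤ) : ℝ)) =
              (B *ᵥ fun i => (c i : ℝ)) - fun i => (z i : ℝ) := by
            rw [← hBL z, ← mulVec_sub]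
            congr 1
            ext i
            simp
          have h2 : (1 : ℤ) ≤ ∑ i, z i := by
            obtain ⟨i, hi⟩ := Function.ne_iff.mp hz0
            exact (Int.add_one_le_iff.mpr (lt_of_le_of_ne (hz i) (Ne.symm hi))).trans
              (Finset.single_le_sum (fun j _ => hz j) (Finset.mem_univ i))
          have h3 : (1 : ℝ) ≤ ∑ i, (z i : ℝ) := by exact_mod_cast h2
          rw [h1]
          simp only [Pi.sub_apply, Finset.sum_sub_distrib]
          push_cast at hlt
          linarith)
        refine ⟨z + w, ?_⟩
        rwa [mulVec_add, ← sub_sub]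
  -- Chosen so that `L w₀ = -(det L)² |c|`; since `(det L)² ≥ 1`, subtracting it makes `c`
  -- non-negative.
  set w₀ : Fin n → ℤ := L.adjugate *ᵥ (-L.det • fun i => |c i|) with hw₀
  have hpos : 0 ≤ c - L *ᵥ w₀ := by
    intro i
    have : (L *ᵥ w₀) i = -(L.det * L.det * |c i|) := by
      rw [hw₀, mulVec_mulVec, mul_adjugate, smul_mulVec, one_mulVec]
      simp [mul_assoc]
    have hd : 1 ≤ L.det * L.det := Int.add_one_le_iff.mpr (mul_self_pos.mpr hdet0)
    have habs := neg_abs_le (c i)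
    have := mul_le_mul_of_nonneg_right hd (abs_nonneg (c i))
    simp only [Pi.zero_apply, Pi.sub_apply, *]
    linarith
  obtain ⟨N, hN⟩ := exists_nat_gt (∑ i, (B *ᵥ fun i => ((c - L *ᵥ w₀) i : ℝ)) i)
  obtain ⟨w, hw⟩ := descend N _ hpos hN
  refine ⟨w₀ + w, ?_⟩
  rwa [mulVec_add, ← sub_sub]

/-- The lattice generated by the columns of a non-singular integer square matrix has index the
absolute value of the determinant. -/
lemma natCard_quotient_range_mulVecLin {n : ℕ} {L : Matrix (Fin n) (Fin n) ℤ} (hL : L.det ≠ 0) :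
    Nat.card ((Fin n → ℤ) ⧸ LinearMap.range L.mulVecLin) = L.det.natAbs := by
  have hinj : Function.Injective L.mulVecLin := by
    rw [← LinearMap.ker_eq_bot, LinearMap.ker_eq_bot']
    exact fun v hv => eq_zero_of_mulVec_eq_zero hL hv
  have h := Submodule.natAbs_det_equiv (LinearMap.range L.mulVecLin)
    (LinearEquiv.ofInjective L.mulVecLin hinj)
  have hcomp : (LinearMap.range L.mulVecLin).subtype ∘ₗ AddMonoidHom.toIntLinearMap
      ((LinearEquiv.ofInjective L.mulVecLin hinj : _ ≃ₗ[ℤ] _) : _ →+ _) = L.toLin' := by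
    ext; rfl
  rw [hcomp, LinearMap.det_toLin'] at h
  exact h.symm

/-- The number of z-superstable configurations of an M-matrix is the absolute value of its
determinant. -/
theorem encard_isZSuperstable {n : ℕ} {L : Matrix (Fin n) (Fin n) ℤ}
    (hL : IsMMatrix (L.map (Int.cast : ℤ → ℝ))) :
    {c | IsZSuperstable L c}.encard = L.det.natAbs := by
  have hdet := hL.det_ne_zero
  have hoff (i j : Fin n) (hij : i ≠ j) : L i j ≤ 0 := by
    have := hL.1 i j hij
    rw [map_apply] at this
    exact_mod_cast this
  set N := LinearMap.range L.mulVecLin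
  have hbij : Set.BijOn N.mkQ {c | IsZSuperstable L c} Set.univ := by
    refine ⟨fun _ _ => Set.mem_univ _, fun c hc d hd hcd => ?_, fun q _ => ?_⟩
    · obtain ⟨w, hw⟩ := (Submodule.Quotient.eq N).mp hcd
      exact hc.eq_of_sub_eq_mulVec hoff hd hw.symm
    · obtain ⟨c, rfl⟩ := N.mkQ_surjective q
      obtain ⟨w, hw⟩ := exists_isZSuperstable_sub_mulVec hL c
      refine ⟨_, hw, (Submodule.Quotient.eq N).mpr ⟨-w, ?_⟩⟩
      simp [mulVec_neg]
  have hcard := natCard_quotient_range_mulVecLin hdet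
  have : Finite ((Fin n → ℤ) ⧸ N) := Nat.finite_of_card_ne_zero (by
    rw [hcard]; exact Int.natAbs_ne_zero.mpr hdet)
  rw [← hbij.injOn.encard_image, hbij.image_eq, ← hcard, Set.encard_univ,
    ENat.card_eq_coe_natCard]

/-! ### Cauchy–Binet for Gram determinants -/

/-- The Cauchy–Binet expansion of a Gram determinant along functions choosing the rows. -/
lemma det_transpose_mul_self_eq_sum {E : Type*} [Fintype E] {n : ℕ} (A : Matrix E (Fin n) ℤ) :
    (Aᵀ * A).det = ∑ p : Fin n → E, (∏ i, A (p i) i) * (A.submatrix p id).det := by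
  classical
  have h : (Aᵀ * A) = fun i => ∑ e, A e i • A e := by
    ext i j
    simp [mul_apply]
  rw [h]
  refine (MultilinearMap.map_sum detRowAlternating.toMultilinearMap
    (fun i e => A e i • A e)).trans ?_
  refine Finset.sum_congr rfl fun p _ => ?_
  rw [MultilinearMap.map_smul_univ]
  rfl

/-- The Cauchy–Binet formula for a Gram determinant, with row sets replaced by their
enumerations. -/
theorem factorial_mul_det_transpose_mul_self {E : Type*} [Fintype E] {n : ℕ}
    (A : Matrix E (Fin n) ℤ) :
    (n.factorial : ℤ) * (Aᵀ * A).det = ∑ p : Fin n → E, (A.submatrix p id).det ^ 2 := by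
  classical
  -- Replacing `p` by `p ∘ σ` permutes the rows of the minor, which costs `sign σ`. Summing over `σ`
  -- then turns the product of entries into a second copy of the minor.
  have h (σ : Equiv.Perm (Fin n)) : (Aᵀ * A).det = ∑ p : Fin n → E,
      (Equiv.Perm.sign σ : ℤ) * (∏ i, A (p (σ i)) i) * (A.submatrix p id).det := by
    rw [det_transpose_mul_self_eq_sum, ← (σ.symm.arrowCongr (Equiv.refl E)).sum_comp]
    refine Finset.sum_congr rfl fun p _ => ?_
    have := det_permute σ (A.submatrix p id)
    rw [submatrix_submatrix] at this
    simp only [Equiv.arrowCongr_apply, Equiv.symm_symm, Equiv.coe_refl,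
      Function.comp_apply]
    change _ * (A.submatrix (p ∘ σ) (id ∘ id)).det = _
    rw [this]
    simp; ring
  calc (n.factorial : ℤ) * (Aᵀ * A).det = ∑ _σ : Equiv.Perm (Fin n), (Aᵀ * A).det := by
        simp [Fintype.card_perm]
    _ = _ := by
        rw [Finset.sum_congr rfl fun σ _ => h σ, Finset.sum_comm]
        refine Finset.sum_congr rfl fun p _ => ?_
        rw [← Finset.sum_mul, sq, det_apply' (A.submatrix p id)]
        rfl

/-! ### Flows, forests and spanning trees -/

section Flow

variable {V : Type*} {G : SimpleGraph V} (o : Orientation G)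

lemma Orientation.tgt_ne_src (e : G.edgeSet) : o.tgt e ≠ o.src e := by
  intro h
  have he := e.2
  rw [← o.mk_src_tgt e, h] at he
  exact G.irrefl ((SimpleGraph.mem_edgeSet G).mp he)

variable [DecidableEq V]

lemma Orientation.incidence_apply (v : V) (e : G.edgeSet) :
    o.incidence v e = (Pi.single (o.tgt e) 1 - Pi.single (o.src e) 1 : V → ℤ) v := by
  have h := o.tgt_ne_src e
  simp only [incidence, of_apply, Pi.sub_apply, Pi.single_apply]
  split_ifs <;> simp_all

lemma Orientation.vecMul_incidence [Fintype V] (y : V → ℤ) (e : G.edgeSet) :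
    (y ᵥ* o.incidence) e = y (o.tgt e) - y (o.src e) := by
  simp [vecMul, dotProduct, o.incidence_apply, mul_sub, Finset.sum_sub_distrib, Pi.single_apply]

variable [Fintype G.edgeSet]

lemma Orientation.mem_flow {x : G.edgeSet → ℤ} : x ∈ o.flow ↔ o.incidence *ᵥ x = 0 :=
  LinearMap.mem_ker

lemma Orientation.incidence_mulVec_single (e : G.edgeSet) (a : ℤ) :
    o.incidence *ᵥ Pi.single e a = a • (Pi.single (o.tgt e) 1 - Pi.single (o.src e) 1) := by
  ext v
  rw [mulVec_single, Pi.smul_apply, Pi.smul_apply, ← o.incidence_apply]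
  simp [mul_comm]

/-- Two vertices joined by a walk in a subgraph `H` of `G` bound an integral chain supported
on `H`. -/
lemma Orientation.exists_incidence_mulVec_eq_of_reachable {H : SimpleGraph V} (hH : H ≤ G)
    {u v : V} (h : H.Reachable u v) :
    ∃ x : G.edgeSet → ℤ, (∀ e : G.edgeSet, (e : Sym2 V) ∉ H.edgeSet → x e = 0) ∧
      o.incidence *ᵥ x = Pi.single v 1 - Pi.single u 1 := by
  obtain ⟨p⟩ := h
  induction p with
  | nil => exact ⟨0, fun _ _ => rfl, by simp⟩
  | @cons u w v huw p ih =>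
    obtain ⟨x, hx, hxv⟩ := ih
    let e : G.edgeSet := ⟨s(u, w), hH huw⟩
    have supp (a : ℤ) (e' : G.edgeSet) (he' : (e' : Sym2 V) ∉ H.edgeSet) :
        (x + Pi.single e a : G.edgeSet → ℤ) e' = 0 := by
      have hne : e' ≠ e := by
        rintro rfl
        exact he' huw
      simp [hx e' he', hne]
    have he : s(o.src e, o.tgt e) = s(u, w) := o.mk_src_tgt e
    rcases Sym2.eq_iff.mp he with ⟨hs, ht⟩ | ⟨hs, ht⟩
    · refine ⟨x + Pi.single e 1, supp 1, ?_⟩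
      rw [mulVec_add, hxv, o.incidence_mulVec_single, hs, ht]
      simp
    · refine ⟨x + Pi.single e (-1), supp (-1), ?_⟩
      rw [mulVec_add, hxv, o.incidence_mulVec_single, hs, ht]
      simp

/-- An edge outside a subgraph `H` whose endpoints are joined in `H` lies on a flow which is
supported on that edge and on `H`. -/
lemma Orientation.exists_mem_flow_of_reachable {H : SimpleGraph V} (hH : H ≤ G) {e : G.edgeSet}
    (he : (e : Sym2 V) ∉ H.edgeSet) (h : H.Reachable (o.src e) (o.tgt e)) :
    ∃ x ∈ o.flow, x e = 1 ∧ ∀ e' : G.edgeSet, e' ≠ e → (e' : Sym2 V) ∉ H.edgeSet → x e' = 0 := by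
  obtain ⟨x, hx, hxv⟩ := o.exists_incidence_mulVec_eq_of_reachable hH h.symm
  refine ⟨x + Pi.single e 1, ?_, by simp [hx e he], fun e' hne he' => by simp [hx e' he', hne]⟩
  rw [o.mem_flow, mulVec_add, hxv, o.incidence_mulVec_single]
  simp

/-- A subgraph that is not a forest supports a nonzero flow. -/
lemma Orientation.exists_ne_zero_mem_flow_of_not_isAcyclic {H : SimpleGraph V} (hH : H ≤ G)
    (h : ¬ H.IsAcyclic) :
    ∃ x ∈ o.flow, x ≠ 0 ∧ ∀ e : G.edgeSet, (e : Sym2 V) ∉ H.edgeSet → x e = 0 := by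
  rw [SimpleGraph.isAcyclic_iff_forall_isBridge] at h
  push Not at h
  obtain ⟨e₀, he₀, hbr⟩ := h
  let e : G.edgeSet := ⟨e₀, SimpleGraph.edgeSet_mono hH he₀⟩
  have hst : s(o.src e, o.tgt e) = e₀ := o.mk_src_tgt e
  rw [← hst, SimpleGraph.isBridge_iff, not_not, hst] at hbr
  obtain ⟨x, hxf, hx1, hx0⟩ := o.exists_mem_flow_of_reachable (e := e)
    ((SimpleGraph.deleteEdges_le _).trans hH) (by simp [e]) hbr
  refine ⟨x, hxf, fun h0 => by simp [h0] at hx1, fun e' he' => hx0 e' ?_ ?_⟩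
  · rintro rfl
    exact he' he₀
  · exact fun h' => he' (SimpleGraph.edgeSet_mono (SimpleGraph.deleteEdges_le _) h')

/-- A forest supports no nonzero flow. -/
lemma Orientation.eq_zero_of_mem_flow_of_isAcyclic [Fintype V] {H : SimpleGraph V}
    (h : H.IsAcyclic) {x : G.edgeSet → ℤ} (hxf : x ∈ o.flow)
    (hx : ∀ e : G.edgeSet, (e : Sym2 V) ∉ H.edgeSet → x e = 0) : x = 0 := by
  classical
  ext e
  by_cases he : (e : Sym2 V) ∈ H.edgeSet
  swap
  · exact hx e he
  have hbr := SimpleGraph.isAcyclic_iff_forall_isBridge.mp h he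
  rw [← o.mk_src_tgt e, SimpleGraph.isBridge_iff, o.mk_src_tgt e] at hbr
  set K := H.deleteEdges {(e : Sym2 V)}
  -- Indicator of one side of the cut that the bridge `e` defines in `H`. Paired with `∂x = 0`, it
  -- leaves only the term of `e`, with coefficient `-1`.
  let y : V → ℤ := fun w => if K.Reachable (o.src e) w then 1 else 0
  have hy (e' : G.edgeSet) (hne : e' ≠ e) (he' : (e' : Sym2 V) ∈ H.edgeSet) :
      y (o.tgt e') = y (o.src e') := by
    have hadj : K.Adj (o.src e') (o.tgt e') := by
      rw [← SimpleGraph.mem_edgeSet, o.mk_src_tgt, SimpleGraph.edgeSet_deleteEdges]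
      exact ⟨he', fun h' => hne (Subtype.ext h')⟩
    have : K.Reachable (o.src e) (o.tgt e') ↔ K.Reachable (o.src e) (o.src e') :=
      ⟨fun h => h.trans hadj.reachable.symm, fun h => h.trans hadj.reachable⟩
    simp only [y, this]
  have hzero : (y ᵥ* o.incidence) ⬝ᵥ x = 0 := by
    rw [← dotProduct_mulVec, o.mem_flow.mp hxf, dotProduct_zero]
  rw [dotProduct, Finset.sum_eq_single e] at hzero
  · simpa [o.vecMul_incidence, y, hbr] using hzero
  · intro e' _ hne
    by_cases he' : (e' : Sym2 V) ∈ H.edgeSet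
    · rw [o.vecMul_incidence, hy e' hne he', sub_self, zero_mul]
    · rw [hx e' he', mul_zero]
  · exact fun h => absurd (Finset.mem_univ e) h

/-- Restriction of flows to the edges outside a subgraph `T`. -/
def Orientation.flowRestrict (T : SimpleGraph V) :
    o.flow →ₗ[ℤ] ({e : G.edgeSet // (e : Sym2 V) ∉ T.edgeSet} → ℤ) :=
  LinearMap.funLeft ℤ ℤ Subtype.val ∘ₗ o.flow.subtype

/-- A flow is determined by its values outside a spanning tree, and these are arbitrary. -/
lemma Orientation.flowRestrict_bijective [Fintype V] {T : SimpleGraph V} (hT : T ≤ G)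
    (hTree : T.IsTree) : Function.Bijective (o.flowRestrict T) := by
  classical
  constructor
  · rw [← LinearMap.ker_eq_bot, LinearMap.ker_eq_bot']
    intro x hx
    exact Subtype.ext (o.eq_zero_of_mem_flow_of_isAcyclic hTree.isAcyclic x.2
      fun e he => congrFun hx ⟨e, he⟩)
  · intro y
    -- The fundamental cycles of `T`: they restrict to the standard basis.
    choose x hxf hx1 hx0 using fun s : {e : G.edgeSet // (e : Sym2 V) ∉ T.edgeSet} =>
      o.exists_mem_flow_of_reachable hT s.2 (hTree.connected.preconnected _ _)
    refine ⟨∑ s, y s • ⟨x s, hxf s⟩, ?_⟩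
    rw [map_sum]
    ext t
    rw [Finset.sum_apply, Finset.sum_eq_single t]
    · simp [flowRestrict, LinearMap.funLeft_apply, hx1]
    · intro s _ hst
      have := hx0 s t (fun h => hst (Subtype.ext h.symm)) t.2
      simp [flowRestrict, LinearMap.funLeft_apply, this]
    · exact fun h => absurd (Finset.mem_univ t) h

/-! ### Maximal minors and the matrix-tree theorem -/

variable {o} {g : ℕ}

/-- The number of edges outside a spanning tree is the rank of the lattice of flows. -/
lemma natCard_compl_isTree_eq (f : Module.Basis (Fin g) ℤ o.flow)
    [Fintype V] {T : SimpleGraph V} (hT : T ≤ G) (hTree : T.IsTree) :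
    Nat.card {e : G.edgeSet // (e : Sym2 V) ∉ T.edgeSet} = g := by
  classical
  have h := (LinearEquiv.ofBijective _ (o.flowRestrict_bijective hT hTree)).finrank_eq
  rw [Module.finrank_eq_card_basis f, Module.finrank_fintype_fun_eq_card, Fintype.card_fin] at h
  rw [Nat.card_eq_fintype_card, h]

/-- The minor is the matrix of the restriction isomorphism in ℤ-bases, so its determinant is a unit
of ℤ. -/
lemma det_basisMatrix_submatrix_sq_of_isTree (f : Module.Basis (Fin g) ℤ o.flow)
    [Fintype V] {T : SimpleGraph V} (hT : T ≤ G)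
    (hTree : T.IsTree) (e : Fin g ≃ {e : G.edgeSet // (e : Sym2 V) ∉ T.edgeSet}) :
    ((basisMatrix f).submatrix (fun i => (e i : G.edgeSet)) id).det ^ 2 = 1 := by
  have h := LinearEquiv.isUnit_det ((LinearEquiv.ofBijective _
    (o.flowRestrict_bijective hT hTree)).trans (LinearEquiv.funCongrLeft ℤ ℤ e)) f
    (Pi.basisFun ℤ (Fin g))
  have hmat : LinearMap.toMatrix f (Pi.basisFun ℤ (Fin g)) ((LinearEquiv.ofBijective _
      (o.flowRestrict_bijective hT hTree)).trans (LinearEquiv.funCongrLeft ℤ ℤ e)).toLinearMap =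
      (basisMatrix f).submatrix (fun i => (e i : G.edgeSet)) id := by
    ext i j
    simp [LinearMap.toMatrix_apply, basisMatrix, Orientation.flowRestrict,
      LinearEquiv.funCongrLeft, LinearMap.funLeft_apply]
  rw [hmat] at h
  exact Int.isUnit_sq h

lemma eq_zero_of_mem_flow_of_det_ne_zero (f : Module.Basis (Fin g) ℤ o.flow)
    {p : Fin g → G.edgeSet}
    (hp : ((basisMatrix f).submatrix p id).det ≠ 0) {x : G.edgeSet → ℤ} (hxf : x ∈ o.flow)
    (hx : ∀ i, x (p i) = 0) : x = 0 := by
  have hrepr : basisMatrix f *ᵥ f.repr ⟨x, hxf⟩ = x := by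
    have h := congrArg Subtype.val (f.sum_repr ⟨x, hxf⟩)
    rw [Submodule.coe_sum] at h
    refine Eq.trans ?_ h
    ext e
    simp [mulVec, dotProduct, basisMatrix, mul_comm]
  have hz : (basisMatrix f).submatrix p id *ᵥ f.repr ⟨x, hxf⟩ = 0 := by
    ext i
    exact (congrFun hrepr (p i)).trans (hx i)
  have h0 := eq_zero_of_mulVec_eq_zero hp hz
  rw [h0, mulVec_zero] at hrepr
  exact hrepr.symm

/-- A nonzero maximal minor of the matrix of a basis of the lattice of flows has the complement of
a spanning tree as its set of rows. -/
lemma exists_isTree_of_det_ne_zero (f : Module.Basis (Fin g) ℤ o.flow)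
    [Fintype V] (hG : G.Connected) {p : Fin g → G.edgeSet}
    (hp : ((basisMatrix f).submatrix p id).det ≠ 0) :
    ∃ T ≤ G, T.IsTree ∧ ∃ e : Fin g ≃ {e : G.edgeSet // (e : Sym2 V) ∉ T.edgeSet},
      p = fun i => (e i : G.edgeSet) := by
  classical
  have hinj : Function.Injective p := fun i j hij => by
    by_contra hne
    exact hp (det_zero_of_row_eq hne (by ext k; simp [hij]))
  let H : SimpleGraph V := G.deleteEdges (Set.range fun i => (p i : Sym2 V))
  have hHG : H ≤ G := SimpleGraph.deleteEdges_le _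
  have hH : H.IsAcyclic := by
    by_contra h
    obtain ⟨x, hxf, hx, hx0⟩ := o.exists_ne_zero_mem_flow_of_not_isAcyclic hHG h
    refine hx (eq_zero_of_mem_flow_of_det_ne_zero f hp hxf fun i => hx0 _ ?_)
    simp [H, SimpleGraph.edgeSet_deleteEdges]
  -- Edges outside `T` are among the rows `p`, and both number `g`, so they coincide.
  obtain ⟨T, hHT, hTG, hT⟩ := hG.exists_isTree_le_of_le_of_isAcyclic hHG hH
  have hmem (e : {e : G.edgeSet // (e : Sym2 V) ∉ T.edgeSet}) : ∃ i, p i = e := by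
    by_contra hne
    push Not at hne
    refine e.2 (SimpleGraph.edgeSet_mono hHT ?_)
    rw [SimpleGraph.edgeSet_deleteEdges]
    refine ⟨e.1.2, ?_⟩
    rintro ⟨i, hi⟩
    exact hne i (Subtype.ext hi)
  choose k hk using hmem
  have hkinj : Function.Injective k := fun a b hab => Subtype.ext (by rw [← hk a, ← hk b, hab])
  have hkbij : Function.Bijective k := by
    rw [Fintype.bijective_iff_injective_and_card]
    refine ⟨hkinj, ?_⟩
    rw [← Nat.card_eq_fintype_card, natCard_compl_isTree_eq f hTG hT, Fintype.card_fin]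
  refine ⟨T, hTG, hT, (Equiv.ofBijective k hkbij).symm, ?_⟩
  ext1 i
  rw [← hk]
  exact congrArg p ((Equiv.ofBijective k hkbij).apply_symm_apply i).symm

/-- The matrix-tree theorem for the dual Laplacian. -/
theorem det_dualLaplacian (f : Module.Basis (Fin g) ℤ o.flow)
    [Fintype V] (hG : G.Connected) :
    (dualLaplacian f).det = Nat.card (spanningTrees G) := by
  classical
  -- Spanning trees with an enumeration of the complement: each tree occurs `g!` times, cancelling
  -- the factorial in Cauchy–Binet.
  let X := Σ T : spanningTrees G, Fin g ≃ {e : G.edgeSet // (e : Sym2 V) ∉ T.1.edgeSet}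
  have : Fintype (spanningTrees G) := Fintype.ofFinite _
  let φ : X → Fin g → G.edgeSet := fun x i => x.2 i
  have hφ : Function.Injective φ := by
    rintro ⟨⟨T, hTG, hT⟩, a⟩ ⟨⟨T', hTG', hT'⟩, b⟩ hab
    have hsub {S S' : SimpleGraph V} (hS : S ≤ G)
        (a : Fin g ≃ {e : G.edgeSet // (e : Sym2 V) ∉ S.edgeSet})
        (b : Fin g ≃ {e : G.edgeSet // (e : Sym2 V) ∉ S'.edgeSet})
        (hab : ∀ i, (a i : G.edgeSet) = b i) : S ≤ S' := by
      rw [← SimpleGraph.edgeSet_subset_edgeSet]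
      intro e he
      by_contra he'
      let e' : {e : G.edgeSet // (e : Sym2 V) ∉ S'.edgeSet} :=
        ⟨⟨e, SimpleGraph.edgeSet_mono hS he⟩, he'⟩
      have h := hab (b.symm e')
      rw [b.apply_symm_apply] at h
      exact (a (b.symm e')).2 (by rw [h]; exact he)
    obtain rfl : T = T' := le_antisymm (hsub hTG a b (congrFun hab))
      (hsub hTG' b a fun i => (congrFun hab i).symm)
    obtain rfl : a = b := Equiv.ext fun i => Subtype.ext (congrFun hab i)
    rfl
  have hcard : Fintype.card X = Fintype.card (spanningTrees G) * g.factorial := by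
    rw [Fintype.card_sigma, Finset.sum_congr rfl fun T _ => ?_, Finset.sum_const, smul_eq_mul,
      Finset.card_univ]
    have h := natCard_compl_isTree_eq f T.2.1 T.2.2
    rw [Nat.card_eq_fintype_card] at h
    rw [Fintype.card_equiv (Fintype.equivOfCardEq (by rw [h, Fintype.card_fin])),
      Fintype.card_fin]
  have hsum : ∑ p : Fin g → G.edgeSet, ((basisMatrix f).submatrix p id).det ^ 2 =
      ∑ _x : X, (1 : ℤ) := by
    refine (Fintype.sum_of_injective φ hφ _ _ (fun p hp => ?_) fun x => ?_).symm
    · by_contra hne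
      obtain ⟨T, hTG, hT, e, rfl⟩ := exists_isTree_of_det_ne_zero f hG
        (fun h => hne (by rw [h]; rfl))
      exact hp ⟨⟨⟨T, hTG, hT⟩, e⟩, rfl⟩
    · exact (det_basisMatrix_submatrix_sq_of_isTree f x.1.2.1 x.1.2.2 x.2).symm
  have h := factorial_mul_det_transpose_mul_self (basisMatrix f)
  rw [hsum, Finset.sum_const, Finset.card_univ, hcard, nsmul_eq_mul, mul_one, Nat.cast_mul,
    mul_comm (Nat.cast _)] at h
  rw [Nat.card_eq_fintype_card]
  exact mul_right_cancel₀ (Nat.cast_ne_zero.mpr g.factorial_ne_zero) h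

end Flow

end CycleChipFiring

theorem proposition3p9 {V : Type*} [Fintype V] [DecidableEq V] (G : SimpleGraph V)
    [DecidableRel G.Adj] (hG : G.Connected) (o : CycleChipFiring.Orientation G) (g : ℕ)
    (f : Module.Basis (Fin g) ℤ o.flow) (hf : CycleChipFiring.IsCycleMBasis f) :
    {c : Fin g → ℤ | CycleChipFiring.IsZSuperstable
        (CycleChipFiring.dualLaplacian f) c}.encard =
      (CycleChipFiring.spanningTrees G).encard := by
  rw [CycleChipFiring.encard_isZSuperstable hf, CycleChipFiring.det_dualLaplacian f hG,
    Int.natAbs_natCast, ← ENat.card_eq_coe_natCard]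
  rfl
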